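/- **Notation.** For a sequence $\mathsf r=(r_n)_{n\ge 1}$ of positive reals let $\mathsf l_{\mathsf r}$ be the Banach space of complex sequences $\mathsf z=(z_n)_{n\ge1}$ with $\|\mathsf z\|_{\mathsf r}:=\sup_n|z_n/r_n|<\infty$; in particular $\mathsf l_{n^{-1}}$ ($r_n=1/n$) and $\mathsf l_{e^{-n}}\subset\mathsf l_{n^{-1}}$ ($r_n=e^{-n}$). Let $\mathsf l^\infty$ be the space of bounded complex sequences. Let $\mathsf C=\{\mathsf z\in\mathsf l_{n^{-1}}: z_n=0\text{ for some }n\}$ be the coordinate cross and $\bar{\mathsf C}$ its closure in $\mathsf l_{n^{-1}}$. A *branch* over $\mathsf z\in\mathsf l_{n^{-1}}\setminus\bar{\mathsf C}$ is a choice of logarithms $\ell=(\ell_n)$, $e^{\ell_n}=z_n$, with bounded arguments, $\sup_n|\mathrm{Im}\,\ell_n|<\infty$. With it put $z_n^s=e^{s\ell_n}$ and, for $\mathsf b\in\mathsf l^\infty$, $$\zeta(\mathsf b,\mathsf z,s)=\sum_{n\ge1}b_nz_n^s\qquad(\mathrm{Re}\,s>1).$$ Let $\mathcal M$ be the set of all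 $(\mathsf b,\mathsf z)$, $\mathsf b\in \mathsf l^\infty$, $\mathsf z\in\mathsf l_{n^{-1}}\setminus\bar{\mathsf C}$, together with a branch over $\mathsf z$, for which $\zeta(\mathsf b,\mathsf z,\cdot)$ (for this branch) continues to a meromorphic function on $\mathbb C$. **Theorem.** Let $(\mathsf b^0,\mathsf z^0)\in\mathcal M$ (with a given branch over $\mathsf z^0$), and put $B=\{\mathsf w\in\mathsf l_{e^{-n}}:\|\mathsf w\|_{e^{-n}}<\|\mathsf z^0\|_{n^{-1}}\}$. (i) Let $\mathsf z\in(\mathsf z^0+B)\setminus\bar{\mathsf C}$. Then the given branch over $\mathsf z^0$ can be continued to a branch over $\mathsf z$ along some path from $\mathsf z^0$ to $\mathsf z$ in $(\mathsf z^0+B)\setminus\bar{\mathsf C}$ (continuous in the norm of $\mathsf l_{e^{-n}}$), and for every branch over $\mathsf z$ obtained by such a continuation $(\mathsf b^0,\mathsf z)\in\mathcal M$; moreover the meromorphic functions $\zeta(\mathsf b^0,\mathsf z,\cdot)$ and $\zeta(\mathsf b^0,\mathsf z^0,\cdot)$ on $\mathbb C$ have the same poles, with the same multiplicities. (ii) The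 function $\zeta(\mathsf b^0,\cdot,\cdot)$, restricted to $\mathsf z\in\mathsf z^0+\mathsf l_{e^{-n}}$, continues to a multivalued meromorphic function of $(\mathsf z,s)$ on $\big((\mathsf z^0+\mathsf l_{e^{-n}})\setminus\bar{\mathsf C}\big)\times\mathbb C$. That is, for every $s_0$ with $\mathrm{Re}\,s_0>1$, the element of this function at $(\mathsf z^0,s_0)$ (given by the branches near the given one) has a meromorphic continuation along every continuous path in this set that starts at $(\mathsf z^0,s_0)$. Here $\mathsf z^0+\mathsf l_{e^{-n}}$ carries the topology of $\mathsf l_{e^{-n}}$. -/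

import Mathlib

open Filter Topology
open scoped ENNReal

/-- A polyradius: a sequence of positive reals indexed by `n = 1, 2, 3, …`. -/
abbrev Polyradius : Type := ℕ+ → {x : ℝ // 0 < x}

/-- The complex sequences `z` with `sup_n |z_n / r_n| < ∞`, as a subspace of all sequences. -/
def seqSubmodule (r : Polyradius) : Submodule ℂ (ℕ+ → ℂ) where
  carrier := {z | BddAbove (Set.range fun n => ‖z n / ((r n : ℝ) : ℂ)‖)}
  zero_mem' := ⟨0, by rintro _ ⟨n, rfl⟩; simp⟩
  add_mem' := by
    rintro a b ⟨A, hA⟩ ⟨B, hB⟩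
    refine ⟨A + B, ?_⟩
    rintro _ ⟨n, rfl⟩
    have h1 := hA ⟨n, rfl⟩
    have h2 := hB ⟨n, rfl⟩
    simp only [Pi.add_apply, add_div] at *
    exact (norm_add_le _ _).trans (add_le_add h1 h2)
  smul_mem' := by
    rintro c a ⟨A, hA⟩
    refine ⟨‖c‖ * A, ?_⟩
    rintro _ ⟨n, rfl⟩
    have h1 := hA ⟨n, rfl⟩
    simp only [Pi.smul_apply, smul_eq_mul, mul_div_assoc, norm_mul] at *
    exact mul_le_mul_of_nonneg_left h1 (norm_nonneg c)

/-- The sequence space `l_r = {z : sup_n |z_n / r_n| < ∞}`. Its norm is `sup_n |z_n / r_n|`,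
see `SeqSpace.norm_eq`. -/
def SeqSpace (r : Polyradius) : Type := seqSubmodule r

namespace SeqSpace

instance (r : Polyradius) : AddCommGroup (SeqSpace r) :=
  inferInstanceAs (AddCommGroup (seqSubmodule r))

instance (r : Polyradius) : Module ℂ (SeqSpace r) :=
  inferInstanceAs (Module ℂ (seqSubmodule r))

/-- The sequence underlying an element of `l_r`. -/
def val {r : Polyradius} (z : SeqSpace r) : ℕ+ → ℂ := Subtype.val z

instance (r : Polyradius) : CoeFun (SeqSpace r) (fun _ => ℕ+ → ℂ) := ⟨val⟩

/-- The linear bijection `z ↦ (z_n / r_n)_n` from `l_r` to `l^∞`, which defines the norm. -/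
noncomputable def toLp (r : Polyradius) : SeqSpace r →ₗ[ℂ] lp (fun _ : ℕ+ => ℂ) ∞ where
  toFun z := ⟨fun n => z n / ((r n : ℝ) : ℂ), memℓp_infty z.2⟩
  map_add' a b := by
    apply Subtype.ext
    funext n
    exact add_div (a n) (b n) _
  map_smul' c a := by
    apply Subtype.ext
    funext n
    exact mul_div_assoc c (a n) _

theorem toLp_injective (r : Polyradius) : Function.Injective (toLp r) := by
  intro a b h
  apply Subtype.ext
  funext n
  have h1 : a n / ((r n : ℝ) : ℂ) = b n / ((r n : ℝ) : ℂ) :=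
    congrFun (congrArg Subtype.val h) n
  have h2 : ((r n : ℝ) : ℂ) ≠ 0 := by exact_mod_cast (r n).2.ne'
  exact (div_left_inj' h2).1 h1

noncomputable instance (r : Polyradius) : NormedAddCommGroup (SeqSpace r) :=
  NormedAddCommGroup.induced (SeqSpace r) (lp (fun _ : ℕ+ => ℂ) ∞) (toLp r) (toLp_injective r)

noncomputable instance (r : Polyradius) : NormedSpace ℂ (SeqSpace r) :=
  NormedSpace.induced ℂ (SeqSpace r) (lp (fun _ : ℕ+ => ℂ) ∞) (toLp r)

theorem norm_eq {r : Polyradius} (z : SeqSpace r) :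
    ‖z‖ = ⨆ n, ‖z n / ((r n : ℝ) : ℂ)‖ := rfl

end SeqSpace

/-- The coordinate cross `C_r = {z ∈ l_r : z_n = 0 for some n}`. -/
def cross (r : Polyradius) : Set (SeqSpace r) := {z | ∃ n, z n = 0}

/-- The polyradius `n⁻¹ = (1/n)_n`. -/
noncomputable def invRad : Polyradius := fun n => ⟨((n : ℕ) : ℝ)⁻¹, by positivity⟩

/-- The polyradius `e^{-n} = (e^{-n})_n`. -/
noncomputable def expRad : Polyradius :=
  fun n => ⟨Real.exp (-((n : ℕ) : ℝ)), Real.exp_pos _⟩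

/-- The inclusion of `l_{e^{-n}}` into `l_{n⁻¹}`. -/
noncomputable def SeqSpace.incl (w : SeqSpace expRad) : SeqSpace invRad :=
  ⟨w.val, by
    obtain ⟨A, hA⟩ := w.2
    refine ⟨A, ?_⟩
    rintro _ ⟨n, rfl⟩
    refine le_trans ?_ (hA ⟨n, rfl⟩)
    have hn : (0 : ℝ) < ((n : ℕ) : ℝ) := by exact_mod_cast n.pos
    have h : Real.exp (-((n : ℕ) : ℝ)) ≤ ((n : ℕ) : ℝ)⁻¹ := by
      rw [Real.exp_neg]
      apply inv_anti₀ hn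
      linarith [Real.add_one_le_exp ((n : ℕ) : ℝ)]
    simp only [norm_div, Complex.norm_real, expRad, invRad, Real.norm_eq_abs, Real.abs_exp,
      abs_of_pos (inv_pos.2 hn)]
    exact div_le_div_of_nonneg_left (norm_nonneg _) (Real.exp_pos _) h⟩

/-- `ℓ` is a choice of logarithms `ℓ_n = log |z_n| + i Arg z_n` of the terms of `z` with bounded
arguments, `sup_n |Arg z_n| < ∞`. For `z` outside the closed cross of `l_{n⁻¹}` these are the
choices obtained by following the arguments continuously along a path from `(1/n)_n` to `z`
outside the closed cross, so they index the branches of the zeta function over `z`. -/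
def IsLogBranch (z ℓ : ℕ+ → ℂ) : Prop :=
  (∀ n, Complex.exp (ℓ n) = z n) ∧ ∃ K : ℝ, ∀ n, |(ℓ n).im| ≤ K

/-- `ζ(b, z, s) = ∑_n b_n z_n^s`, where `z_n^s = exp (s ℓ_n)`. -/
noncomputable def zetaBranch (b ℓ : ℕ+ → ℂ) (s : ℂ) : ℂ :=
  ∑' n, b n * Complex.exp (s * ℓ n)

/-- `F` is a meromorphic continuation to `ℂ` of the branch `ℓ` of `ζ(b, z, ·)`, which is given by
its series for `Re s > 1`. -/
def IsZetaExtension (b ℓ : ℕ+ → ℂ) (F : ℂ → ℂ) : Prop :=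
  Meromorphic F ∧ ∀ s : ℂ, 1 < s.re → F s = zetaBranch b ℓ s

/-- The set `M` over `l^∞ × (l_{n⁻¹} ∖ closure of the cross)`: the triples `(b, z, ℓ)`, with `ℓ` a
branch over `z`, for which this branch of `ζ(b, z, ·)` continues meromorphically to `ℂ`. -/
def zetaM : Set (lp (fun _ : ℕ+ => ℂ) ∞ × SeqSpace invRad × (ℕ+ → ℂ)) :=
  {p | p.2.1 ∉ closure (cross invRad) ∧ IsLogBranch p.2.1 p.2.2 ∧
    ∃ F, IsZetaExtension p.1 p.2.2 F}

/-- Two functions of `s` have the same poles, with the same multiplicities. -/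
def SamePoles (F G : ℂ → ℂ) : Prop :=
  ∀ s, min (meromorphicOrderAt F s) 0 = min (meromorphicOrderAt G s) 0

/-- The branch `ℓ` over `z⁰ + w` is the continuation of the branch `ℓ₀` over `z⁰` along some path
`z⁰ + γ`, where `γ` is a path from `0` to `w` inside `D ⊆ l_{e^{-n}}`: there are logarithms of all
terms, continuous along the path, that start from `ℓ₀` and end with `ℓ`. -/
def BranchContinues (z₀ : SeqSpace invRad) (ℓ₀ : ℕ+ → ℂ) (D : Set (SeqSpace expRad))
    (w : SeqSpace expRad) (ℓ : ℕ+ → ℂ) : Prop :=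
  ∃ γ : Path (0 : SeqSpace expRad) w, (∀ t, γ t ∈ D) ∧
    ∃ L : unitInterval → ℕ+ → ℂ, (∀ n, Continuous fun t => L t n) ∧
      (∀ t n, Complex.exp (L t n) = z₀ n + γ t n) ∧ L 0 = ℓ₀ ∧ L 1 = ℓ

/-- `(z⁰ + l_{e^{-n}}) ∖ closure of the cross`, with the origin of the affine space at `z⁰`. -/
def affineDomain (z₀ : SeqSpace invRad) : Set (SeqSpace expRad) :=
  {w | z₀ + w.incl ∉ closure (cross invRad)}

section Meromorphic

variable {E : Type*} [NormedAddCommGroup E] [NormedSpace ℂ E]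

/-- `f` is meromorphic on the set `V` of a complex normed space: near each point of `V` it is a
quotient `g / h` of holomorphic functions, where `h` does not vanish identically on any nonempty
open set. The value of `f` at zeros of `h` carries no information. -/
def IsMeromorphicIn (f : E → ℂ) (V : Set E) : Prop :=
  ∀ x ∈ V, ∃ W : Set E, IsOpen W ∧ x ∈ W ∧ ∃ g h : E → ℂ,
    DifferentiableOn ℂ g W ∧ DifferentiableOn ℂ h W ∧
    W ⊆ closure {y | y ∈ W ∧ h y ≠ 0} ∧ ∀ y ∈ W, h y ≠ 0 → f y = g y / h y

/-- `f` and `g` are equal as meromorphic functions on the open set `V`, that is, on a dense open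
subset of `V`. -/
def MeromorphicEq (f g : E → ℂ) (V : Set E) : Prop :=
  V ⊆ closure (interior {y | f y = g y})

/-- The element `f₀`, given near `γ(0)`, has a meromorphic continuation along the path `γ`: open
connected neighbourhoods `V_t` of `γ(t)` and meromorphic functions `f_t` on `V_t` such that
`f_{t₁} = f_{t₂}` on `V_{t₁} ∩ V_{t₂}` for `|t₁ - t₂|` small enough, and `f_0 = f₀` near `γ(0)`. -/
def ContinuesAlong (f₀ : E → ℂ) (γ : C(unitInterval, E)) : Prop :=
  ∃ (V : unitInterval → Set E) (f : unitInterval → E → ℂ),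
    (∀ t, IsOpen (V t) ∧ IsConnected (V t) ∧ γ t ∈ V t ∧ IsMeromorphicIn (f t) (V t)) ∧
    (∃ δ : ℝ, 0 < δ ∧ ∀ t₁ t₂, dist t₁ t₂ < δ → MeromorphicEq (f t₁) (f t₂) (V t₁ ∩ V t₂)) ∧
    ∀ᶠ x in 𝓝 (γ 0), f 0 x = f₀ x

/-- The element `f₀` at `x₀` continues to a multivalued meromorphic function on `D`: it continues
meromorphically along every path in `D` that starts at `x₀`. -/
def ContinuesMultivalued (f₀ : E → ℂ) (x₀ : E) (D : Set E) : Prop :=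
  ∀ γ : C(unitInterval, E), γ 0 = x₀ → (∀ t, γ t ∈ D) → ContinuesAlong f₀ γ

end Meromorphic

/-- The restriction of `ζ(b, ·, ·)` near `(z⁰, s)`, `Re s > 1`, as a function of
`(w, s) ∈ l_{e^{-n}} × ℂ` with `z = z⁰ + w`: the sum `∑_n b_n (z⁰_n + w_n)^s`, where the logarithm
`ℓ₀_n + Log (1 + w_n / z⁰_n)` of `z⁰_n + w_n` is the one close to `ℓ₀_n`. -/
noncomputable def zetaElement (b : ℕ+ → ℂ) (z₀ : SeqSpace invRad) (ℓ₀ : ℕ+ → ℂ)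
    (p : SeqSpace expRad × ℂ) : ℂ :=
  zetaBranch b (fun n => ℓ₀ n + Complex.log (1 + p.1 n / z₀ n)) p.2

/-! The continuation reduces to one estimate. Distance from the closed cross forces `|z₀ n| ≥ c /
n`, while a point `w` of `l_{e^{-n}}` has `|w n| ≤ ‖w‖ e^{-n}`; so the relative perturbation `w n /
z₀ n`, and with it the change of logarithm, is `O(n e^{-n})`. Since `exp (s ℓ₀_n)` grows at most
polynomially in `n`, uniformly for bounded `s`, the termwise difference of the two series converges
for every `s`, locally uniformly. Hence each continued branch is the original zeta function plus an
entire function of `s`, which leaves the poles alone (`SamePoles.of_eqOn_add`).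

The estimate must survive continuation along a path, where the arguments may wind. By compactness
all but finitely many coordinates stay within half of `|z₀ n|` of `z₀ n`, so their lift is the
principal one; the finitely many others only enlarge the constant (`exists_bound_of_lift`). For the
multivalued statement the same series, with local logarithms on balls of one fixed radius along the
path, is holomorphic in `(w, s)` jointly (`differentiableOn_zetaDiff`).

Existence of a path comes from the complex line through `0` and `w`, which meets the cross in
countably many points. -/

theorem Complex.exists_continuous_log_lift {f : unitInterval → ℂ} (hf : Continuous f)
    (hf0 : ∀ t, f t ≠ 0) {a : ℂ} (ha : Complex.exp a = f 0) :
    ∃ L : unitInterval → ℂ, Continuous L ∧ (∀ t, Complex.exp (L t) = f t) ∧ L 0 = a := by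
  let g : C(unitInterval, {z : ℂ // z ≠ 0}) := ⟨fun t => ⟨f t, hf0 t⟩, hf.subtype_mk _⟩
  obtain ⟨Γ, hΓ, hΓ0⟩ := Complex.isCoveringMap_exp.exists_path_lifts g a (Subtype.ext ha.symm)
  exact ⟨Γ, Γ.continuous, fun t => congrArg Subtype.val (congrFun hΓ t), hΓ0⟩

theorem Complex.eqOn_of_exp_eqOn {X : Type*} [TopologicalSpace X] {S : Set X}
    (hS : IsPreconnected S) {f g : X → ℂ} (hf : ContinuousOn f S) (hg : ContinuousOn g S)
    (h : ∀ x ∈ S, Complex.exp (f x) = Complex.exp (g x)) {a : X} (ha : a ∈ S) (hfg : f a = g a) :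
    Set.EqOn f g S :=
  Complex.isCoveringMap_exp.eqOn_of_comp_eqOn hS hf hg (fun x hx => Subtype.ext (h x hx)) ha hfg

theorem Complex.norm_exp_sub_one_le_mul_exp (x : ℂ) :
    ‖Complex.exp x - 1‖ ≤ ‖x‖ * Real.exp ‖x‖ := by
  simpa using Complex.norm_exp_sub_sum_le_norm_mul_exp x 1

/-! ### Series of holomorphic functions on a normed space -/

/-- Cauchy's estimate for the one-variable restriction `t ↦ f (x + t v)`, `‖v‖ = 1`, on the disc of
radius `R`; the larger ball keeps the closed disc inside the domain. -/
theorem norm_fderiv_le_of_forall_mem_ball {E : Type*} [NormedAddCommGroup E] [NormedSpace ℂ E]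
    {f : E → ℂ} {x : E} {R C : ℝ} (hR : 0 < R) (hC : 0 ≤ C)
    (hf : DifferentiableOn ℂ f (Metric.ball x (2 * R)))
    (hb : ∀ y ∈ Metric.ball x (2 * R), ‖f y‖ ≤ C) : ‖fderiv ℂ f x‖ ≤ C / R := by
  refine ContinuousLinearMap.opNorm_le_of_unit_norm (𝕜 := ℂ) (by positivity) fun v hv => ?_
  let l : ℂ → E := fun t => x + t • v
  have hl : ∀ t : ℂ, ‖t‖ < 2 * R → l t ∈ Metric.ball x (2 * R) := fun t ht => by
    simpa [l, norm_smul, hv] using ht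
  have hld : Differentiable ℂ l := by fun_prop
  have hd : DiffContOnCl ℂ (f ∘ l) (Metric.ball 0 R) := by
    refine DifferentiableOn.diffContOnCl_ball (U := Metric.ball 0 (2 * R)) ?_ ?_
    · exact hf.comp hld.differentiableOn fun t ht => hl t (by simpa using ht)
    · exact Metric.closedBall_subset_ball (by linarith)
  have key := Complex.norm_deriv_le_of_forall_mem_sphere_norm_le hR hd fun t ht =>
    hb (l t) (hl t (by rw [mem_sphere_zero_iff_norm.1 ht]; linarith))
  have hx : HasFDerivAt f (fderiv ℂ f x) (l 0) := by
    have : l 0 = x := by simp [l]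
    rw [this]
    exact (hf.differentiableAt (Metric.ball_mem_nhds x (by linarith))).hasFDerivAt
  have hl' : HasDerivAt l v 0 := by
    simpa [l] using ((hasDerivAt_id (0 : ℂ)).smul_const v).const_add x
  rwa [(hx.comp_hasDerivAt (0 : ℂ) hl').deriv] at key

/-- Weierstrass's theorem: Cauchy's estimate turns the majorant of the terms into one of their
derivatives, which allows termwise differentiation. -/
theorem differentiableOn_tsum_of_norm_le {ι E : Type*} [NormedAddCommGroup E] [NormedSpace ℂ E]
    {f : ι → E → ℂ} {u : ι → ℝ} {U : Set E} (hu : Summable u) (hU : IsOpen U)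
    (hf : ∀ n, DifferentiableOn ℂ (f n) U) (hb : ∀ n, ∀ y ∈ U, ‖f n y‖ ≤ u n) :
    DifferentiableOn ℂ (fun y => ∑' n, f n y) U := by
  intro x hx
  obtain ⟨ε, hε, hball⟩ := Metric.isOpen_iff.1 hU x hx
  have hsub : ∀ y ∈ Metric.ball x (ε / 2), Metric.ball y (2 * (ε / 4)) ⊆ U := fun y hy =>
    (Metric.ball_subset_ball' (by rw [Metric.mem_ball] at hy; linarith)).trans hball
  have hxb : x ∈ Metric.ball x (ε / 2) := Metric.mem_ball_self (by linarith)
  have : NormedSpace ℝ E := NormedSpace.restrictScalars ℝ ℂ E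
  have h := hasFDerivAt_tsum_of_isPreconnected (f' := fun n y => fderiv ℂ (f n) y) (f := f)
    (hu.div_const (ε / 4)) Metric.isOpen_ball (convex_ball x (ε / 2)).isPreconnected
    (fun n y hy => ((hf n).differentiableAt
      (hU.mem_nhds (hsub y hy (Metric.mem_ball_self (by linarith))))).hasFDerivAt)
    (fun n y hy => norm_fderiv_le_of_forall_mem_ball (by linarith)
      ((norm_nonneg _).trans (hb n x hx)) ((hf n).mono (hsub y hy))
      fun y' hy' => hb n y' (hsub y hy hy'))
    hxb (Summable.of_norm_bounded hu fun n => hb n x hx) hxb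
  exact h.differentiableAt.differentiableWithinAt

/-! ### Coordinates and the distance to the cross -/

namespace SeqSpace

variable {r : Polyradius}

theorem norm_apply_le (z : SeqSpace r) (n : ℕ+) : ‖z n‖ ≤ ‖z‖ * r n := by
  have h : ‖z n / ((r n : ℝ) : ℂ)‖ ≤ ‖z‖ := le_ciSup z.2 n
  rwa [norm_div, Complex.norm_real, Real.norm_of_nonneg (r n).2.le, div_le_iff₀ (r n).2] at h

theorem norm_le_of_forall {z : SeqSpace r} {C : ℝ} (h : ∀ n, ‖z n‖ ≤ C * r n) : ‖z‖ ≤ C := by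
  refine ciSup_le fun n => ?_
  change ‖z n / ((r n : ℝ) : ℂ)‖ ≤ C
  rw [norm_div, Complex.norm_real, Real.norm_of_nonneg (r n).2.le, div_le_iff₀ (r n).2]
  exact h n

/-- The `n`-th coordinate as a continuous linear functional. -/
noncomputable def coord (r : Polyradius) (n : ℕ+) : SeqSpace r →L[ℂ] ℂ :=
  LinearMap.mkContinuous
    { toFun := fun z => z n
      map_add' := fun _ _ => rfl
      map_smul' := fun _ _ => rfl } (r n)
    fun z => (norm_apply_le z n).trans_eq (mul_comm _ _)

theorem add_apply (z w : SeqSpace r) (n : ℕ+) : (z + w) n = z n + w n := rfl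

theorem sub_apply (z w : SeqSpace r) (n : ℕ+) : (z - w) n = z n - w n := rfl

theorem smul_apply (c : ℂ) (z : SeqSpace r) (n : ℕ+) : (c • z) n = c * z n := rfl

theorem zero_apply (n : ℕ+) : (0 : SeqSpace r) n = 0 := rfl

/-- Replacing the `n`-th coordinate by zero gives a point of the cross at exactly this distance. -/
theorem infDist_closure_cross_le (z : SeqSpace r) (n : ℕ+) :
    Metric.infDist z (closure (cross r)) ≤ ‖z n‖ / r n := by
  have hv : ∀ m, ‖Function.update z.val n 0 m‖ ≤ ‖z m‖ := fun m => by
    rcases eq_or_ne m n with rfl | h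
    · simp
    · simp [h]
  let v : SeqSpace r := ⟨Function.update z.val n 0, by
    obtain ⟨A, hA⟩ := z.2
    refine ⟨A, ?_⟩
    rintro _ ⟨m, rfl⟩
    refine le_trans ?_ (hA ⟨m, rfl⟩)
    simp only [norm_div]
    exact div_le_div_of_nonneg_right (hv m) (norm_nonneg _)⟩
  have hvc : v ∈ cross r := ⟨n, Function.update_self ..⟩
  rw [Metric.infDist_closure]
  refine (Metric.infDist_le_dist_of_mem hvc).trans ?_
  rw [dist_eq_norm]
  refine norm_le_of_forall fun m => ?_
  have hr := (r n).2
  have hr' := (r m).2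
  rw [sub_apply]
  rcases eq_or_ne m n with rfl | h
  · have : v m = 0 := Function.update_self ..
    rw [this, sub_zero, div_mul_cancel₀ _ hr.ne']
  · have : v m = z m := Function.update_of_ne h ..
    rw [this, sub_self, norm_zero]
    positivity

theorem exists_lower_bound {z : SeqSpace r} (hz : z ∉ closure (cross r)) :
    ∃ c > 0, ∀ n, c * r n ≤ ‖z n‖ := by
  by_cases hne : (cross r).Nonempty
  · refine ⟨_, (isClosed_closure.notMem_iff_infDist_pos hne.closure).1 hz, fun n => ?_⟩
    exact (le_div_iff₀ (r n).2).1 (infDist_closure_cross_le z n)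
  · exact absurd ⟨0, 1, rfl⟩ hne

theorem notMem_closure_cross {z : SeqSpace r} {c : ℝ} (hc : 0 < c)
    (h : ∀ n, c * r n ≤ ‖z n‖) : z ∉ closure (cross r) := by
  intro hz
  obtain ⟨v, ⟨n, hv⟩, hd⟩ := Metric.mem_closure_iff.1 hz c hc
  have h1 := norm_apply_le (z - v) n
  rw [sub_apply, hv, sub_zero, ← dist_eq_norm] at h1
  have := mul_lt_mul_of_pos_right hd (r n).2
  linarith [h n]

theorem ne_zero_of_notMem {z : SeqSpace r} (hz : z ∉ closure (cross r)) (n : ℕ+) : z n ≠ 0 :=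
  fun h => hz (subset_closure ⟨n, h⟩)

theorem continuous_incl : Continuous incl := by
  refine (LipschitzWith.of_dist_le_mul (K := 1) fun a b => ?_).continuous
  rw [NNReal.coe_one, one_mul, dist_eq_norm, dist_eq_norm]
  refine norm_le_of_forall fun n => ?_
  have h := norm_apply_le (a - b) n
  refine h.trans (mul_le_mul_of_nonneg_left ?_ (norm_nonneg _))
  have hn : (0 : ℝ) < ((n : ℕ) : ℝ) := by exact_mod_cast n.pos
  change Real.exp (-((n : ℕ) : ℝ)) ≤ ((n : ℕ) : ℝ)⁻¹
  rw [Real.exp_neg]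
  apply inv_anti₀ hn
  linarith [Real.add_one_le_exp ((n : ℕ) : ℝ)]

end SeqSpace

/-! ### Growth of logarithms and convergence for `Re s > 1` -/

theorem PNat.mul_exp_neg_le_one (n : ℕ+) : ((n : ℕ) : ℝ) * Real.exp (-((n : ℕ) : ℝ)) ≤ 1 := by
  rw [Real.exp_neg, ← div_eq_mul_inv, div_le_one (Real.exp_pos _)]
  linarith [Real.add_one_le_exp ((n : ℕ) : ℝ)]

theorem PNat.summable_pow_mul_exp_neg (k : ℕ) :
    Summable fun n : ℕ+ => ((n : ℕ) : ℝ) ^ k * Real.exp (-((n : ℕ) : ℝ)) := by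
  have h := Real.summable_pow_mul_exp_neg_nat_mul k one_pos
  simp only [neg_mul, one_mul] at h
  exact h.comp_injective PNat.coe_injective

theorem PNat.tendsto_mul_exp_neg :
    Tendsto (fun n : ℕ+ => ((n : ℕ) : ℝ) * Real.exp (-((n : ℕ) : ℝ))) cofinite (𝓝 0) := by
  simpa using (PNat.summable_pow_mul_exp_neg 1).tendsto_cofinite_zero

theorem norm_div_le_mul_exp_neg {a x : ℂ} {c d : ℝ} {n : ℕ+} (hc : 0 < c)
    (ha : c * ((n : ℕ) : ℝ)⁻¹ ≤ ‖a‖) (hx : ‖x‖ ≤ d * Real.exp (-((n : ℕ) : ℝ))) :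
    ‖x / a‖ ≤ d / c * (((n : ℕ) : ℝ) * Real.exp (-((n : ℕ) : ℝ))) := by
  have hn : (0 : ℝ) < ((n : ℕ) : ℝ) := by exact_mod_cast n.pos
  rw [norm_div]
  refine (div_le_div₀ ((norm_nonneg _).trans hx) hx (by positivity) ha).trans_eq ?_
  field_simp

/-- `log |z n| = -log n + O(1)`: the norm of `z` gives the upper bound, the distance to the cross
the lower one. -/
theorem IsLogBranch.exists_bound {z : SeqSpace invRad} {ℓ : ℕ+ → ℂ}
    (hz : z ∉ closure (cross invRad)) (hℓ : IsLogBranch z ℓ) :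
    ∃ K, 0 ≤ K ∧ ∀ n : ℕ+, |(ℓ n).re + Real.log (n : ℕ)| ≤ K ∧ |(ℓ n).im| ≤ K := by
  obtain ⟨c, hc, hcz⟩ := SeqSpace.exists_lower_bound hz
  obtain ⟨hexp, K, hK⟩ := hℓ
  have key : ∀ n : ℕ+, Real.log c ≤ (ℓ n).re + Real.log (n : ℕ) ∧
      (ℓ n).re + Real.log (n : ℕ) ≤ Real.log ‖z‖ := fun n => by
    have hn : (0 : ℝ) < ((n : ℕ) : ℝ) := by exact_mod_cast n.pos
    have h1 := hcz n
    have h2 := SeqSpace.norm_apply_le z n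
    change c * ((n : ℕ) : ℝ)⁻¹ ≤ _ at h1
    change _ ≤ ‖z‖ * ((n : ℕ) : ℝ)⁻¹ at h2
    rw [← div_eq_mul_inv, ← hexp n, Complex.norm_exp, div_le_iff₀ hn] at h1
    rw [← div_eq_mul_inv, ← hexp n, Complex.norm_exp, le_div_iff₀ hn] at h2
    have h3 : Real.log (Real.exp (ℓ n).re * (n : ℕ)) = (ℓ n).re + Real.log (n : ℕ) := by
      rw [Real.log_mul (Real.exp_pos _).ne' hn.ne', Real.log_exp]
    rw [← h3]
    exact ⟨Real.log_le_log hc h1, Real.log_le_log (by positivity) h2⟩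
  refine ⟨max K (max |Real.log c| |Real.log ‖z‖|), ?_, fun n => ⟨?_, (hK n).trans (le_max_left _ _)⟩⟩
  · exact (abs_nonneg _).trans ((le_max_left _ _).trans (le_max_right _ _))
  · refine le_trans ?_ (le_max_right _ _)
    exact abs_le_max_abs_abs (key n).1 (key n).2

theorem lp.norm_apply_le_norm_top (b : lp (fun _ : ℕ+ => ℂ) ∞) (n : ℕ+) : ‖b n‖ ≤ ‖b‖ :=
  lp.norm_apply_le_norm ENNReal.top_ne_zero b n

theorem IsLogBranch.summable {z : SeqSpace invRad} {ℓ : ℕ+ → ℂ}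
    (hz : z ∉ closure (cross invRad)) (hℓ : IsLogBranch z ℓ) (b : lp (fun _ : ℕ+ => ℂ) ∞)
    {s : ℂ} (hs : 1 < s.re) : Summable fun n => b n * Complex.exp (s * ℓ n) := by
  obtain ⟨K, hK0, hK⟩ := hℓ.exists_bound hz
  have hsum : Summable fun n : ℕ+ => ((n : ℕ) : ℝ) ^ (-s.re) :=
    (Real.summable_nat_rpow.2 (by linarith)).comp_injective PNat.coe_injective
  refine Summable.of_norm_bounded (hsum.mul_left (‖b‖ * Real.exp (s.re * K + |s.im| * K)))
    fun n => ?_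
  have hn : (0 : ℝ) < ((n : ℕ) : ℝ) := by exact_mod_cast n.pos
  rw [norm_mul, Complex.norm_exp, mul_assoc, Real.rpow_def_of_pos hn, ← Real.exp_add]
  refine mul_le_mul (lp.norm_apply_le_norm_top b n) (Real.exp_le_exp.2 ?_) (Real.exp_pos _).le
    (norm_nonneg _)
  obtain ⟨h1, h2⟩ := hK n
  have h3 : s.re * ((ℓ n).re + Real.log (n : ℕ)) ≤ s.re * K :=
    mul_le_mul_of_nonneg_left ((le_abs_self _).trans h1) (by linarith)
  have h4 : -(s.im * (ℓ n).im) ≤ |s.im| * K := by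
    refine (neg_le_abs _).trans ?_
    rw [abs_mul]
    exact mul_le_mul_of_nonneg_left h2 (abs_nonneg _)
  rw [Complex.mul_re]
  linarith

/-! ### The difference of two branches -/

/-- The termwise difference `∑ b_n (exp (s ℓ_n) - exp (s ℓ₀_n))` of two branches. -/
noncomputable def zetaDiff (b ℓ₀ ℓ : ℕ+ → ℂ) (s : ℂ) : ℂ :=
  ∑' n, b n * (Complex.exp (s * ℓ n) - Complex.exp (s * ℓ₀ n))

theorem zetaBranch_eq_add_zetaDiff {z z' : SeqSpace invRad} {ℓ ℓ' : ℕ+ → ℂ}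
    (hz : z ∉ closure (cross invRad)) (hℓ : IsLogBranch z ℓ)
    (hz' : z' ∉ closure (cross invRad)) (hℓ' : IsLogBranch z' ℓ')
    (b : lp (fun _ : ℕ+ => ℂ) ∞) {s : ℂ} (hs : 1 < s.re) :
    zetaBranch b ℓ' s = zetaBranch b ℓ s + zetaDiff b ℓ ℓ' s := by
  simp only [zetaBranch, zetaDiff, mul_sub]
  rw [(hℓ'.summable hz' b hs).tsum_sub (hℓ.summable hz b hs)]
  ring

/-- Factor out `exp (s ℓ₀_n)`, of size `O(n^S)`; the remaining `exp (s (a - ℓ₀_n)) - 1` is `O(n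
e^{-n})`, so exponential decay wins for every `S`. -/
theorem exists_summable_zetaDiff_bound {ℓ₀ : ℕ+ → ℂ} {K A : ℝ} (hA : 0 ≤ A)
    (hℓ₀ : ∀ n : ℕ+, ‖ℓ₀ n‖ ≤ Real.log (n : ℕ) + K) (b : lp (fun _ : ℕ+ => ℂ) ∞) (S : ℕ) :
    ∃ u : ℕ+ → ℝ, Summable u ∧ ∀ (n : ℕ+) (s a : ℂ), ‖s‖ ≤ S →
      ‖a - ℓ₀ n‖ ≤ A * (((n : ℕ) : ℝ) * Real.exp (-((n : ℕ) : ℝ))) →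
      ‖b n * (Complex.exp (s * a) - Complex.exp (s * ℓ₀ n))‖ ≤ u n := by
  refine ⟨fun n => ‖b‖ * (Real.exp (S * K) * (S * A) * Real.exp (S * A) *
    (((n : ℕ) : ℝ) ^ (S + 1) * Real.exp (-((n : ℕ) : ℝ)))),
    ((PNat.summable_pow_mul_exp_neg (S + 1)).mul_left _).mul_left _, fun n s a hs ha => ?_⟩
  have hn : (0 : ℝ) < ((n : ℕ) : ℝ) := by exact_mod_cast n.pos
  set q := ((n : ℕ) : ℝ) * Real.exp (-((n : ℕ) : ℝ)) with hq
  have hS : (0 : ℝ) ≤ S := S.cast_nonneg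
  have hq0 : 0 ≤ q := by positivity
  have hq1 : q ≤ 1 := PNat.mul_exp_neg_le_one n
  have h0 : ‖s * (a - ℓ₀ n)‖ ≤ S * A * q := by
    rw [norm_mul, mul_assoc]
    exact mul_le_mul hs ha (norm_nonneg _) hS
  have h1 : ‖Complex.exp (s * (a - ℓ₀ n)) - 1‖ ≤ S * A * q * Real.exp (S * A) := by
    refine (Complex.norm_exp_sub_one_le_mul_exp _).trans ?_
    refine mul_le_mul h0 (Real.exp_le_exp.2 (h0.trans ?_)) (Real.exp_pos _).le (by positivity)
    exact mul_le_of_le_one_right (by positivity) hq1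
  have h2 : ‖Complex.exp (s * ℓ₀ n)‖ ≤ ((n : ℕ) : ℝ) ^ S * Real.exp (S * K) := by
    refine (Complex.norm_exp_le_exp_norm _).trans ?_
    have : ((n : ℕ) : ℝ) ^ S = Real.exp (S * Real.log (n : ℕ)) := by
      rw [Real.exp_nat_mul, Real.exp_log hn]
    rw [this, ← Real.exp_add, ← mul_add, norm_mul]
    exact Real.exp_le_exp.2 (mul_le_mul hs (hℓ₀ n) (norm_nonneg _) hS)
  have h3 : Complex.exp (s * a) - Complex.exp (s * ℓ₀ n) =
      Complex.exp (s * ℓ₀ n) * (Complex.exp (s * (a - ℓ₀ n)) - 1) := by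
    rw [mul_sub, mul_one, ← Complex.exp_add]
    ring_nf
  rw [h3, norm_mul, norm_mul]
  refine mul_le_mul (lp.norm_apply_le_norm_top b n) ?_ (by positivity) (norm_nonneg _)
  refine (mul_le_mul h2 h1 (norm_nonneg _) (by positivity)).trans_eq ?_
  rw [hq]
  ring

theorem differentiableOn_zetaDiff {E : Type*} [NormedAddCommGroup E] [NormedSpace ℂ E]
    {ℓ₀ : ℕ+ → ℂ} {K A : ℝ} (hℓ₀ : ∀ n : ℕ+, ‖ℓ₀ n‖ ≤ Real.log (n : ℕ) + K) (hA : 0 ≤ A)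
    (b : lp (fun _ : ℕ+ => ℂ) ∞) {U : Set E} (hU : IsOpen U) {Λ : E → ℕ+ → ℂ}
    (hΛ : ∀ n, DifferentiableOn ℂ (fun x => Λ x n) U)
    (hbd : ∀ x ∈ U, ∀ n : ℕ+,
      ‖Λ x n - ℓ₀ n‖ ≤ A * (((n : ℕ) : ℝ) * Real.exp (-((n : ℕ) : ℝ)))) :
    DifferentiableOn ℂ (fun p : E × ℂ => zetaDiff b ℓ₀ (Λ p.1) p.2) (U ×ˢ Set.univ) := by
  rintro ⟨x, s⟩ ⟨hx, -⟩
  obtain ⟨S, hS⟩ := exists_nat_gt ‖s‖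
  obtain ⟨u, hu, hub⟩ := exists_summable_zetaDiff_bound hA hℓ₀ b S
  have hopen : IsOpen (U ×ˢ Metric.ball (0 : ℂ) S) := hU.prod Metric.isOpen_ball
  have hd : DifferentiableOn ℂ (fun p : E × ℂ => zetaDiff b ℓ₀ (Λ p.1) p.2)
      (U ×ˢ Metric.ball (0 : ℂ) S) := by
    refine differentiableOn_tsum_of_norm_le hu hopen (fun n => ?_) fun n p hp => ?_
    · have h1 : DifferentiableOn ℂ (fun p : E × ℂ => Λ p.1 n) (U ×ˢ Metric.ball (0 : ℂ) S) :=
        (hΛ n).comp differentiableOn_fst fun p hp => hp.1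
      have h2 : DifferentiableOn ℂ (fun p : E × ℂ => p.2) (U ×ˢ Metric.ball (0 : ℂ) S) :=
        differentiableOn_snd
      exact ((h2.mul h1).cexp.sub (h2.mul_const _).cexp).const_mul _
    · exact hub n p.2 _ (mem_ball_zero_iff.1 hp.2).le (hbd p.1 hp.1 n)
  exact (hd.differentiableAt (hopen.mem_nhds ⟨hx, mem_ball_zero_iff.2 hS⟩)).differentiableWithinAt

/-! ### Local logarithms -/

/-- The logarithm of `z₀_n + w_n`, for `w` near `v`, with value `a_n` at `w = v`. -/
noncomputable def localLog (z₀ : SeqSpace invRad) (v : SeqSpace expRad) (a : ℕ+ → ℂ)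
    (w : SeqSpace expRad) (n : ℕ+) : ℂ :=
  a n + Complex.log (1 + (w n - v n) / (z₀ n + v n))

section localLog

variable {z₀ : SeqSpace invRad} {v : SeqSpace expRad} {a : ℕ+ → ℂ} {c : ℝ}

theorem localLog_self (n : ℕ+) : localLog z₀ v a v n = a n := by
  simp [localLog]

theorem norm_div_le_of_mem_ball (hc : 0 < c) (hv : ∀ n : ℕ+, c * ((n : ℕ) : ℝ)⁻¹ ≤ ‖z₀ n + v n‖)
    {w : SeqSpace expRad} (hw : w ∈ Metric.ball v (c / 2)) (n : ℕ+) :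
    ‖(w n - v n) / (z₀ n + v n)‖ ≤ 1 / 2 * (((n : ℕ) : ℝ) * Real.exp (-((n : ℕ) : ℝ))) := by
  have h1 : ‖w n - v n‖ ≤ c / 2 * Real.exp (-((n : ℕ) : ℝ)) := by
    refine (SeqSpace.norm_apply_le (w - v) n).trans ?_
    rw [← dist_eq_norm]
    exact mul_le_mul_of_nonneg_right (Metric.mem_ball.1 hw).le (Real.exp_pos _).le
  refine (norm_div_le_mul_exp_neg hc (hv n) h1).trans_eq ?_
  field_simp

theorem norm_div_le_half_of_mem_ball (hc : 0 < c)
    (hv : ∀ n : ℕ+, c * ((n : ℕ) : ℝ)⁻¹ ≤ ‖z₀ n + v n‖)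
    {w : SeqSpace expRad} (hw : w ∈ Metric.ball v (c / 2)) (n : ℕ+) :
    ‖(w n - v n) / (z₀ n + v n)‖ ≤ 1 / 2 :=
  (norm_div_le_of_mem_ball hc hv hw n).trans
    (mul_le_of_le_one_right (by norm_num) (PNat.mul_exp_neg_le_one n))

theorem exp_localLog (hc : 0 < c) (hv : ∀ n : ℕ+, c * ((n : ℕ) : ℝ)⁻¹ ≤ ‖z₀ n + v n‖)
    (ha : ∀ n, Complex.exp (a n) = z₀ n + v n)
    {w : SeqSpace expRad} (hw : w ∈ Metric.ball v (c / 2)) (n : ℕ+) :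
    Complex.exp (localLog z₀ v a w n) = z₀ n + w n := by
  have h := norm_div_le_half_of_mem_ball hc hv hw n
  have h0 : z₀ n + v n ≠ 0 := by
    rw [← ha n]
    exact Complex.exp_ne_zero _
  have h1 : 1 + (w n - v n) / (z₀ n + v n) ≠ 0 :=
    Complex.slitPlane_ne_zero (Complex.mem_slitPlane_of_norm_lt_one (by linarith))
  rw [localLog, Complex.exp_add, ha, Complex.exp_log h1]
  field_simp
  ring

theorem differentiableOn_localLog (hc : 0 < c)
    (hv : ∀ n : ℕ+, c * ((n : ℕ) : ℝ)⁻¹ ≤ ‖z₀ n + v n‖) (n : ℕ+) :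
    DifferentiableOn ℂ (fun w => localLog z₀ v a w n) (Metric.ball v (c / 2)) := by
  intro w hw
  have h := norm_div_le_half_of_mem_ball hc hv hw n
  have hd : DifferentiableAt ℂ (fun w : SeqSpace expRad => w n) w :=
    (SeqSpace.coord expRad n).differentiableAt
  refine DifferentiableAt.differentiableWithinAt ?_
  refine DifferentiableAt.const_add _ (DifferentiableAt.clog ?_ ?_)
  · simp only [div_eq_mul_inv]
    exact ((hd.sub_const _).mul_const _).const_add 1
  · exact Complex.mem_slitPlane_of_norm_lt_one (by linarith)

theorem norm_localLog_sub_le (hc : 0 < c)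
    (hv : ∀ n : ℕ+, c * ((n : ℕ) : ℝ)⁻¹ ≤ ‖z₀ n + v n‖)
    {w : SeqSpace expRad} (hw : w ∈ Metric.ball v (c / 2)) (n : ℕ+) :
    ‖localLog z₀ v a w n - a n‖ ≤ ((n : ℕ) : ℝ) * Real.exp (-((n : ℕ) : ℝ)) := by
  have h := norm_div_le_of_mem_ball hc hv hw n
  have h' := norm_div_le_half_of_mem_ball hc hv hw n
  rw [localLog, add_sub_cancel_left]
  refine (Complex.norm_log_one_add_half_le_self h').trans ?_
  have : 0 ≤ ((n : ℕ) : ℝ) * Real.exp (-((n : ℕ) : ℝ)) := by positivity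
  linarith

end localLog

/-! ### Logarithms along a path -/

theorem exists_uniform_lower_bound {z₀ : SeqSpace invRad} {σ : unitInterval → SeqSpace expRad}
    (hσ : Continuous σ) (hD : ∀ t, σ t ∈ affineDomain z₀) :
    ∃ c > 0, ∀ t, ∀ n : ℕ+, c * ((n : ℕ) : ℝ)⁻¹ ≤ ‖z₀ n + σ t n‖ := by
  have hcont : Continuous fun t =>
      Metric.infDist (z₀ + (σ t).incl) (closure (cross invRad)) :=
    (Metric.continuous_infDist_pt _).comp
      (continuous_const.add (SeqSpace.continuous_incl.comp hσ))
  obtain ⟨t₀, -, ht₀⟩ := isCompact_univ.exists_isMinOn Set.univ_nonempty hcont.continuousOn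
  have hne : (cross invRad).Nonempty := ⟨0, 1, rfl⟩
  refine ⟨_, (isClosed_closure.notMem_iff_infDist_pos hne.closure).1 (hD t₀), fun t n => ?_⟩
  refine (le_div_iff₀ (invRad n).2).1 ((ht₀ (Set.mem_univ t)).trans ?_)
  exact SeqSpace.infDist_closure_cross_le (z₀ + (σ t).incl) n

/-- A lift can differ from the principal logarithm only at the finitely many indices where the path
is not small relative to `z₀ n`. -/
theorem exists_bound_of_lift {z₀ : SeqSpace invRad} {ℓ₀ : ℕ+ → ℂ}
    {σ : unitInterval → SeqSpace expRad} (hσ : Continuous σ) (hσ0 : σ 0 = 0)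
    (hz₀ : z₀ ∉ closure (cross invRad)) {L : unitInterval → ℕ+ → ℂ}
    (hL : ∀ n, Continuous fun t => L t n) (hexp : ∀ t n, Complex.exp (L t n) = z₀ n + σ t n)
    (hL0 : L 0 = ℓ₀) (t : unitInterval) :
    ∃ A, 0 ≤ A ∧ ∀ n : ℕ+,
      ‖L t n - ℓ₀ n‖ ≤ A * (((n : ℕ) : ℝ) * Real.exp (-((n : ℕ) : ℝ))) := by
  obtain ⟨c, hc, hcz⟩ := SeqSpace.exists_lower_bound hz₀
  obtain ⟨M, hM⟩ := isCompact_univ.exists_bound_of_continuousOn hσ.continuousOn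
  have hq : ∀ τ, ∀ n : ℕ+,
      ‖σ τ n / z₀ n‖ ≤ M / c * (((n : ℕ) : ℝ) * Real.exp (-((n : ℕ) : ℝ))) := fun τ n =>
    norm_div_le_mul_exp_neg hc (hcz n) ((SeqSpace.norm_apply_le (σ τ) n).trans
      (mul_le_mul_of_nonneg_right (hM τ (Set.mem_univ τ)) (Real.exp_pos _).le))
  have hev : ∀ᶠ n : ℕ+ in cofinite,
      M / c * (((n : ℕ) : ℝ) * Real.exp (-((n : ℕ) : ℝ))) ≤ 1 / 2 := by
    have := PNat.tendsto_mul_exp_neg.const_mul (M / c)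
    rw [mul_zero] at this
    exact this.eventually_le_const (by norm_num)
  have hO : (fun n : ℕ+ => L t n - ℓ₀ n) =O[cofinite]
      fun n : ℕ+ => ((n : ℕ) : ℝ) * Real.exp (-((n : ℕ) : ℝ)) := by
    refine Asymptotics.IsBigO.of_bound (3 / 2 * (M / c)) ?_
    filter_upwards [hev] with n hn
    have hsmall : ∀ τ, ‖σ τ n / z₀ n‖ ≤ 1 / 2 := fun τ => (hq τ n).trans hn
    have hslit : ∀ τ, 1 + σ τ n / z₀ n ∈ Complex.slitPlane := fun τ =>
      Complex.mem_slitPlane_of_norm_lt_one (by linarith [hsmall τ])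
    have hz0 : z₀ n ≠ 0 := SeqSpace.ne_zero_of_notMem hz₀ n
    have hσn : Continuous fun τ => σ τ n := (SeqSpace.coord expRad n).continuous.comp hσ
    -- Two continuous logarithms of the same path with equal start agree throughout, so no winding
    -- occurs at such `n`.
    have heq := Complex.eqOn_of_exp_eqOn (S := Set.univ) isPreconnected_univ
      (f := fun τ => L τ n) (g := fun τ => ℓ₀ n + Complex.log (1 + σ τ n / z₀ n))
      (hL n).continuousOn
      (continuous_const.add ((continuous_const.add (hσn.div_const _)).clog hslit)).continuousOn
      (fun τ _ => by
        have h0 : Complex.exp (ℓ₀ n) = z₀ n := by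
          rw [← hL0, hexp, hσ0, SeqSpace.zero_apply, add_zero]
        rw [hexp, Complex.exp_add, Complex.exp_log (Complex.slitPlane_ne_zero (hslit τ)), h0]
        field_simp)
      (Set.mem_univ 0) (by simp [hL0, hσ0, SeqSpace.zero_apply])
    have ht : L t n - ℓ₀ n = Complex.log (1 + σ t n / z₀ n) := by
      rw [show L t n = _ from heq (Set.mem_univ t), add_sub_cancel_left]
    rw [ht, Real.norm_of_nonneg (by positivity), mul_assoc]
    exact (Complex.norm_log_one_add_half_le_self (hsmall t)).trans
      (mul_le_mul_of_nonneg_left (hq t n) (by norm_num))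
  -- The comparison sequence never vanishes, so the exceptional indices can be absorbed into `A`.
  obtain ⟨A, hA, hAb⟩ := Asymptotics.bound_of_isBigO_cofinite hO
  refine ⟨A, hA.le, fun n => ?_⟩
  have hpos : 0 < ((n : ℕ) : ℝ) * Real.exp (-((n : ℕ) : ℝ)) :=
    mul_pos (by exact_mod_cast n.pos) (Real.exp_pos _)
  have := hAb (x := n) hpos.ne'
  rwa [Real.norm_of_nonneg hpos.le] at this

theorem IsLogBranch.of_bound {z z' ℓ ℓ' : ℕ+ → ℂ} {A : ℝ} (hA : 0 ≤ A) (hℓ : IsLogBranch z ℓ)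
    (hexp : ∀ n, Complex.exp (ℓ' n) = z' n)
    (hbd : ∀ n : ℕ+, ‖ℓ' n - ℓ n‖ ≤ A * (((n : ℕ) : ℝ) * Real.exp (-((n : ℕ) : ℝ)))) :
    IsLogBranch z' ℓ' := by
  obtain ⟨K, hK⟩ := hℓ.2
  refine ⟨hexp, K + A, fun n => ?_⟩
  have h1 : |(ℓ' n - ℓ n).im| ≤ A := (Complex.abs_im_le_norm _).trans
    ((hbd n).trans (mul_le_of_le_one_right hA (PNat.mul_exp_neg_le_one n)))
  have h2 : (ℓ' n).im = (ℓ n).im + (ℓ' n - ℓ n).im := by simp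
  rw [h2]
  exact (abs_add_le _ _).trans (add_le_add (hK n) h1)

theorem IsLogBranch.exists_norm_le {z : SeqSpace invRad} {ℓ : ℕ+ → ℂ}
    (hz : z ∉ closure (cross invRad)) (hℓ : IsLogBranch z ℓ) :
    ∃ K, ∀ n : ℕ+, ‖ℓ n‖ ≤ Real.log (n : ℕ) + K := by
  obtain ⟨K, hK0, hK⟩ := hℓ.exists_bound hz
  refine ⟨2 * K, fun n => ?_⟩
  have hlog : 0 ≤ Real.log ((n : ℕ) : ℝ) := Real.log_natCast_nonneg _
  obtain ⟨h1, h2⟩ := hK n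
  have h3 : |(ℓ n).re| ≤ Real.log (n : ℕ) + K := by
    rw [abs_le] at h1 ⊢
    constructor <;> linarith [h1.1, h1.2]
  linarith [Complex.norm_le_abs_re_add_abs_im (ℓ n)]

theorem differentiable_zetaDiff {ℓ₀ ℓ : ℕ+ → ℂ} {K A : ℝ}
    (hℓ₀ : ∀ n : ℕ+, ‖ℓ₀ n‖ ≤ Real.log (n : ℕ) + K) (hA : 0 ≤ A) (b : lp (fun _ : ℕ+ => ℂ) ∞)
    (hbd : ∀ n : ℕ+, ‖ℓ n - ℓ₀ n‖ ≤ A * (((n : ℕ) : ℝ) * Real.exp (-((n : ℕ) : ℝ)))) :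
    Differentiable ℂ (zetaDiff b ℓ₀ ℓ) := by
  have h := differentiableOn_zetaDiff (E := ℂ) (Λ := fun _ => ℓ) hℓ₀ hA b isOpen_univ
    (fun n => differentiableOn_const _) fun _ _ => hbd
  rw [Set.univ_prod_univ, differentiableOn_univ] at h
  exact h.comp ((differentiable_const (0 : ℂ)).prodMk differentiable_id)

/-! ### Paths that avoid the cross -/

/-- A small arc from `0` to `1` in the plane that avoids a given countable set. -/
theorem exists_arc_avoiding {ε : ℝ} (hε : 0 < ε) (p : ℕ+ → ℂ) (hp0 : ∀ n, p n ≠ 0)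
    (hp1 : ∀ n, p n ≠ 1) :
    ∃ y : ℝ, 0 < y ∧ y < ε ∧ ∀ (t : ℝ) (n : ℕ+),
      (t : ℂ) + (y * (t * (1 - t)) : ℝ) * Complex.I ≠ p n := by
  -- Each `p n` lies on the arc for at most one height `y`, found by solving for it; an interval of
  -- heights is uncountable.
  have hcount : (Set.range fun n => (p n).im / ((p n).re * (1 - (p n).re))).Countable :=
    Set.countable_range _
  obtain ⟨y, hy, hyn⟩ := Set.not_subset.1 fun h : Set.Ioo 0 ε ⊆ _ =>
    (Cardinal.Real.Ioo_countable_iff.1 (hcount.mono h)).not_gt hε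
  refine ⟨y, hy.1, hy.2, fun t n h => hyn ⟨n, ?_⟩⟩
  have hre : (p n).re = t := by rw [← h]; simp
  have him : (p n).im = y * (t * (1 - t)) := by rw [← h]; simp
  have ht0 : t ≠ 0 := fun h0 => hp0 n (Complex.ext (by simp [hre, h0]) (by simp [him, h0]))
  have ht1 : 1 - t ≠ 0 := fun h1 => by
    refine hp1 n (Complex.ext ?_ (by simp [him, h1]))
    rw [hre, Complex.one_re]
    linarith
  simp only [hre, him]
  field_simp

/-- Passing to the closure of the cross adds no point of `z₀ + l_{e^{-n}}`: `n |z₀ n + w n| ≥ c / 2`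
for all but finitely many `n`, and the others are nonzero. -/
theorem mem_affineDomain_of_forall_ne_zero {z₀ : SeqSpace invRad}
    (hz₀ : z₀ ∉ closure (cross invRad)) {w : SeqSpace expRad} (hw : ∀ n, z₀ n + w n ≠ 0) :
    w ∈ affineDomain z₀ := by
  obtain ⟨c, hc, hcz⟩ := SeqSpace.exists_lower_bound hz₀
  have hO : (fun n : ℕ+ => (((n : ℕ) : ℝ) * ‖z₀ n + w n‖)⁻¹) =O[cofinite] fun _ => (1 : ℝ) := by
    refine Asymptotics.IsBigO.of_bound (c / 2)⁻¹ ?_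
    have hlim := PNat.tendsto_mul_exp_neg.const_mul ‖w‖
    rw [mul_zero] at hlim
    filter_upwards [hlim.eventually_le_const (half_pos hc)] with n hn
    have hn0 : (0 : ℝ) < ((n : ℕ) : ℝ) := by exact_mod_cast n.pos
    rw [Real.norm_of_nonneg (by positivity), norm_one, mul_one]
    refine inv_anti₀ (by linarith) ?_
    have h1 : c ≤ (n : ℕ) * ‖z₀ n‖ := by
      have := mul_le_mul_of_nonneg_left (hcz n) hn0.le
      change ((n : ℕ) : ℝ) * (c * ((n : ℕ) : ℝ)⁻¹) ≤ _ at this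
      rwa [mul_left_comm, mul_inv_cancel₀ hn0.ne', mul_one] at this
    have h2 : (n : ℕ) * ‖w n‖ ≤ c / 2 := by
      refine le_trans ?_ hn
      rw [mul_left_comm]
      exact mul_le_mul_of_nonneg_left (SeqSpace.norm_apply_le w n) hn0.le
    have h3 : ‖z₀ n‖ ≤ ‖z₀ n + w n‖ + ‖w n‖ := by
      simpa using norm_sub_le (z₀ n + w n) (w n)
    have h4 := mul_le_mul_of_nonneg_left h3 hn0.le
    rw [mul_add] at h4
    linarith
  obtain ⟨C, hC, hCb⟩ := Asymptotics.bound_of_isBigO_cofinite hO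
  refine SeqSpace.notMem_closure_cross (inv_pos.2 hC) fun n => ?_
  have hn0 : (0 : ℝ) < ((n : ℕ) : ℝ) := by exact_mod_cast n.pos
  have hpos : 0 < ((n : ℕ) : ℝ) * ‖z₀ n + w n‖ := mul_pos hn0 (norm_pos_iff.2 (hw n))
  have h := hCb (x := n) one_ne_zero
  rw [norm_one, mul_one, Real.norm_of_nonneg (by positivity)] at h
  have h' := inv_anti₀ (by positivity) h
  rw [inv_inv] at h'
  change C⁻¹ * ((n : ℕ) : ℝ)⁻¹ ≤ ‖z₀ n + w n‖
  rw [← div_eq_mul_inv, div_le_iff₀ hn0]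
  linarith

theorem exists_lift {z₀ : SeqSpace invRad} {ℓ₀ : ℕ+ → ℂ} (hℓ₀ : IsLogBranch z₀ ℓ₀)
    {σ : unitInterval → SeqSpace expRad} (hσ : Continuous σ) (hσ0 : σ 0 = 0)
    (hD : ∀ t, σ t ∈ affineDomain z₀) :
    ∃ L : unitInterval → ℕ+ → ℂ, (∀ n, Continuous fun t => L t n) ∧
      (∀ t n, Complex.exp (L t n) = z₀ n + σ t n) ∧ L 0 = ℓ₀ := by
  have h : ∀ n : ℕ+, ∃ L : unitInterval → ℂ, Continuous L ∧
      (∀ t, Complex.exp (L t) = z₀ n + σ t n) ∧ L 0 = ℓ₀ n := fun n =>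
    Complex.exists_continuous_log_lift (f := fun t => z₀ n + σ t n)
      (continuous_const.add ((SeqSpace.coord expRad n).continuous.comp hσ))
      (fun t => SeqSpace.ne_zero_of_notMem (hD t) n)
      (by rw [hℓ₀.1 n, hσ0, SeqSpace.zero_apply, add_zero])
  choose L h1 h2 h3 using h
  exact ⟨fun t n => L n t, h1, fun t n => h2 n t, funext h3⟩

theorem exists_branchContinues {z₀ : SeqSpace invRad} {ℓ₀ : ℕ+ → ℂ}
    (hz₀ : z₀ ∉ closure (cross invRad)) (hℓ₀ : IsLogBranch z₀ ℓ₀) {R : ℝ} {w : SeqSpace expRad}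
    (hw : w ∈ Metric.ball 0 R) (hwD : w ∈ affineDomain z₀) :
    ∃ ℓ, BranchContinues z₀ ℓ₀ (Metric.ball 0 R ∩ affineDomain z₀) w ℓ := by
  have hwR : ‖w‖ < R := mem_ball_zero_iff.1 hw
  have hw0 : 0 ≤ ‖w‖ := norm_nonneg w
  -- Arc height below this bound gives `(1 + y) ‖w‖ < R`, which keeps the path in the ball.
  have hε : 0 < (R - ‖w‖) / (‖w‖ + 1) := by
    have : 0 < R - ‖w‖ := by linarith
    positivity
  have hz := SeqSpace.ne_zero_of_notMem hz₀
  have hzw : ∀ n, z₀ n + w n ≠ 0 := SeqSpace.ne_zero_of_notMem hwD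
  obtain ⟨y, hy0, hyε, hy⟩ := exists_arc_avoiding hε
    -- The parameters where coordinate `n` vanishes; `2` is a dummy, different from `0` and `1`, for
    -- coordinates that stay constant.
    (fun n => if w n = 0 then 2 else -z₀ n / w n)
    (fun n => by
      split_ifs with h
      · norm_num
      · exact div_ne_zero (neg_ne_zero.2 (hz n)) h)
    (fun n => by
      split_ifs with h
      · norm_num
      · rw [Ne, div_eq_one_iff_eq h]
        intro h'
        exact hzw n (by rw [← h', add_neg_cancel]))
  let φ : unitInterval → ℂ := fun t =>
    ((t : ℝ) : ℂ) + (y * ((t : ℝ) * (1 - (t : ℝ))) : ℝ) * Complex.I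
  have hφ : Continuous φ := by fun_prop
  have hφn : ∀ t, ‖φ t‖ ≤ 1 + y := fun t => by
    obtain ⟨h0, h1⟩ := t.2
    have h2 : (t : ℝ) * (1 - (t : ℝ)) ≤ 1 := by nlinarith
    have h3 : 0 ≤ (t : ℝ) * (1 - (t : ℝ)) := mul_nonneg h0 (by linarith)
    refine (norm_add_le _ _).trans (add_le_add ?_ ?_)
    · rwa [Complex.norm_real, Real.norm_of_nonneg h0]
    · rw [norm_mul, Complex.norm_I, mul_one, Complex.norm_real, Real.norm_of_nonneg (by positivity)]
      exact mul_le_of_le_one_right hy0.le h2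
  let γ : Path (0 : SeqSpace expRad) w :=
    { toFun := fun t => φ t • w
      continuous_toFun := hφ.smul continuous_const
      source' := by simp [φ]
      target' := by simp [φ] }
  have hγ : ∀ t, γ t = φ t • w := fun t => rfl
  have hD : ∀ t, γ t ∈ affineDomain z₀ := fun t => by
    refine mem_affineDomain_of_forall_ne_zero hz₀ fun n h => ?_
    rw [hγ, SeqSpace.smul_apply] at h
    have hwn : w n ≠ 0 := fun h0 => hz n (by simpa [h0] using h)
    apply hy t n
    rw [if_neg hwn]
    exact (eq_div_iff hwn).2 (by linear_combination h)
  have hB : ∀ t, γ t ∈ Metric.ball 0 R := fun t => by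
    rw [mem_ball_zero_iff, hγ, norm_smul]
    have h1 := mul_le_mul_of_nonneg_right (hφn t) hw0
    rw [lt_div_iff₀ (by positivity)] at hyε
    linarith
  obtain ⟨L, h1, h2, h3⟩ := exists_lift hℓ₀ γ.continuous γ.source hD
  exact ⟨L 1, γ, fun t => ⟨hB t, hD t⟩, L, h1, h2, h3, rfl⟩

/-! ### Poles and meromorphy of the continuation -/

theorem SamePoles.of_eqOn_add {F F₀ H : ℂ → ℂ} (hF : Meromorphic F) (hF₀ : Meromorphic F₀)
    (hH : Differentiable ℂ H) {U : Set ℂ} (hU : IsOpen U) (hne : U.Nonempty)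
    (h : ∀ s ∈ U, F s = F₀ s + H s) : SamePoles F F₀ := by
  have hHa : ∀ s, AnalyticAt ℂ H s := fun s => hH.analyticAt s
  have hHm : Meromorphic H := fun s => (hHa s).meromorphicAt
  have hG : Meromorphic (F - (F₀ + H)) := hF.sub (hF₀.add hHm)
  obtain ⟨a, ha⟩ := hne
  have htop : meromorphicOrderAt (F - (F₀ + H)) a = ⊤ := by
    rw [meromorphicOrderAt_eq_top_iff]
    filter_upwards [mem_nhdsWithin_of_mem_nhds (hU.mem_nhds ha)] with s hs
    simp [h s hs]
  intro s
  -- Identity theorem: infinite order at one point of `ℂ` forces it at all.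
  have htop' : meromorphicOrderAt (F - (F₀ + H)) s = ⊤ := by
    by_contra hs
    exact (hG.exists_meromorphicOrderAt_ne_top_iff_forall.1 ⟨s, hs⟩) a htop
  have hcongr : meromorphicOrderAt F s = meromorphicOrderAt (F₀ + H) s := by
    refine meromorphicOrderAt_congr ?_
    filter_upwards [meromorphicOrderAt_eq_top_iff.1 htop'] with u hu
    exact sub_eq_zero.1 hu
  have hH0 : 0 ≤ meromorphicOrderAt H s := (hHa s).meromorphicOrderAt_nonneg
  rw [hcongr]
  rcases lt_or_ge (meromorphicOrderAt F₀ s) 0 with hlt | hge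
  · rw [meromorphicOrderAt_add_eq_left_of_lt (hHm s) (hlt.trans_le hH0)]
  · have := meromorphicOrderAt_add (hF₀ s) (hHm s)
    rw [min_eq_right hge, min_eq_right ((le_min hge hH0).trans this)]

/-- The denominator can be taken as a power of `s - a`, independent of the point of `E`, since `H`
is holomorphic. -/
theorem isMeromorphicIn_add {E : Type*} [NormedAddCommGroup E] [NormedSpace ℂ E] {F : ℂ → ℂ}
    (hF : Meromorphic F) {U : Set E} (hU : IsOpen U) {H : E × ℂ → ℂ}
    (hH : DifferentiableOn ℂ H (U ×ˢ Set.univ)) :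
    IsMeromorphicIn (fun p : E × ℂ => F p.2 + H p) (U ×ˢ Set.univ) := by
  rintro ⟨x, a⟩ ⟨hx, -⟩
  obtain ⟨k, hk⟩ := hF a
  obtain ⟨ε, hε, hball⟩ := Metric.eventually_nhds_iff_ball.1 hk.eventually_analyticAt
  have hW : IsOpen (U ×ˢ Metric.ball a ε) := hU.prod Metric.isOpen_ball
  have hh : Differentiable ℂ fun p : E × ℂ => (p.2 - a) ^ k := by fun_prop
  have hgF : DifferentiableOn ℂ (fun s => (s - a) ^ k • F s) (Metric.ball a ε) := fun s hs =>
    (hball s hs).differentiableAt.differentiableWithinAt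
  refine ⟨U ×ˢ Metric.ball a ε, hW, ⟨hx, Metric.mem_ball_self hε⟩,
    fun p => (p.2 - a) ^ k • F p.2 + (p.2 - a) ^ k * H p, fun p => (p.2 - a) ^ k, ?_,
    hh.differentiableOn, ?_, fun p _ hp => ?_⟩
  · refine DifferentiableOn.add (hgF.comp differentiableOn_snd fun p hp => hp.2) ?_
    exact hh.differentiableOn.mul (hH.mono (Set.prod_mono_right (Set.subset_univ _)))
  · have hd : Dense (Set.univ ×ˢ {a}ᶜ : Set (E × ℂ)) := dense_univ.prod (dense_compl_singleton a)
    refine (hd.open_subset_closure_inter hW).trans (closure_mono ?_)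
    rintro p ⟨hp, -, hpa⟩
    exact ⟨hp, pow_ne_zero _ (sub_ne_zero.2 hpa)⟩
  · simp only [smul_eq_mul]
    rw [← mul_add, mul_div_cancel_left₀ _ hp]

/-- Nearby local logarithms along a continuous lift agree where both are defined. -/
theorem localLog_eq_of_lift {z₀ : SeqSpace invRad} {σ : unitInterval → SeqSpace expRad}
    (hσ : Continuous σ) {c : ℝ} (hc : 0 < c)
    (hlow : ∀ t, ∀ n : ℕ+, c * ((n : ℕ) : ℝ)⁻¹ ≤ ‖z₀ n + σ t n‖) {L : unitInterval → ℕ+ → ℂ}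
    (hL : ∀ n, Continuous fun t => L t n) (hexp : ∀ t n, Complex.exp (L t n) = z₀ n + σ t n)
    {t₁ t₂ : unitInterval} (hnear : ∀ τ ∈ Set.uIcc t₁ t₂, σ τ ∈ Metric.ball (σ t₂) (c / 2))
    {w : SeqSpace expRad} (hw₁ : w ∈ Metric.ball (σ t₁) (c / 2))
    (hw₂ : w ∈ Metric.ball (σ t₂) (c / 2)) (n : ℕ+) :
    localLog z₀ (σ t₁) (L t₁) w n = localLog z₀ (σ t₂) (L t₂) w n := by
  -- Compare first along the path between the two times, then spread the equality from `σ t₁` over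
  -- the convex intersection of the balls.
  have h1 : L t₁ n = localLog z₀ (σ t₂) (L t₂) (σ t₁) n := by
    refine Complex.eqOn_of_exp_eqOn (S := Set.uIcc t₁ t₂) (f := fun τ => L τ n)
      (g := fun τ => localLog z₀ (σ t₂) (L t₂) (σ τ) n) isPreconnected_uIcc (hL n).continuousOn
      ?_ (fun τ hτ => ?_) Set.right_mem_uIcc (localLog_self n).symm Set.left_mem_uIcc
    · exact (differentiableOn_localLog hc (hlow t₂) n).continuousOn.comp hσ.continuousOn hnear
    · rw [hexp, exp_localLog hc (hlow t₂) (hexp t₂) (hnear τ hτ)]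
  have : NormedSpace ℝ (SeqSpace expRad) := NormedSpace.restrictScalars ℝ ℂ _
  have hconv : IsPreconnected (Metric.ball (σ t₁) (c / 2) ∩ Metric.ball (σ t₂) (c / 2)) :=
    ((convex_ball _ _).inter (convex_ball _ _)).isPreconnected
  have ht : σ t₁ ∈ Metric.ball (σ t₁) (c / 2) ∩ Metric.ball (σ t₂) (c / 2) :=
    ⟨Metric.mem_ball_self (half_pos hc), hnear t₁ Set.left_mem_uIcc⟩
  refine Complex.eqOn_of_exp_eqOn hconv
    ((differentiableOn_localLog hc (hlow t₁) n).continuousOn.mono Set.inter_subset_left)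
    ((differentiableOn_localLog hc (hlow t₂) n).continuousOn.mono Set.inter_subset_right)
    (fun v hv => ?_) ht ?_ ⟨hw₁, hw₂⟩
  · rw [exp_localLog hc (hlow t₁) (hexp t₁) hv.1, exp_localLog hc (hlow t₂) (hexp t₂) hv.2]
  · rw [localLog_self, h1]

theorem continuesMultivalued_zetaElement {b : lp (fun _ : ℕ+ => ℂ) ∞} {z₀ : SeqSpace invRad}
    {ℓ₀ : ℕ+ → ℂ} (hz₀ : z₀ ∉ closure (cross invRad)) (hℓ₀ : IsLogBranch z₀ ℓ₀) {F₀ : ℂ → ℂ}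
    (hF₀ : IsZetaExtension b ℓ₀ F₀) {s₀ : ℂ} (hs₀ : 1 < s₀.re) :
    ContinuesMultivalued (zetaElement b z₀ ℓ₀) (0, s₀)
      (affineDomain z₀ ×ˢ (Set.univ : Set ℂ)) := by
  intro γ hγ0 hγD
  let σ : unitInterval → SeqSpace expRad := fun t => (γ t).1
  have hσ : Continuous σ := γ.continuous.fst
  have hσ0 : σ 0 = 0 := congrArg Prod.fst hγ0
  have hσD : ∀ t, σ t ∈ affineDomain z₀ := fun t => (hγD t).1
  obtain ⟨K, hK⟩ := hℓ₀.exists_norm_le hz₀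
  obtain ⟨c, hc, hlow⟩ := exists_uniform_lower_bound hσ hσD
  obtain ⟨L, hL, hexp, hL0⟩ := exists_lift hℓ₀ hσ hσ0 hσD
  let U : unitInterval → Set (SeqSpace expRad) := fun t => Metric.ball (σ t) (c / 2)
  let Λ : unitInterval → SeqSpace expRad → ℕ+ → ℂ := fun t => localLog z₀ (σ t) (L t)
  have hΛ : ∀ t, ∃ A, 0 ≤ A ∧ ∀ w ∈ U t, ∀ n : ℕ+,
      ‖Λ t w n - ℓ₀ n‖ ≤ A * (((n : ℕ) : ℝ) * Real.exp (-((n : ℕ) : ℝ))) := fun t => by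
    obtain ⟨A, hA, hAb⟩ := exists_bound_of_lift hσ hσ0 hz₀ hL hexp hL0 t
    refine ⟨1 + A, by linarith, fun w hw n => ?_⟩
    have h := norm_add_le (Λ t w n - L t n) (L t n - ℓ₀ n)
    rw [sub_add_sub_cancel] at h
    linarith [hAb n, norm_localLog_sub_le (a := L t) hc (hlow t) hw n]
  have : NormedSpace ℝ (SeqSpace expRad) := NormedSpace.restrictScalars ℝ ℂ _
  refine ⟨fun t => U t ×ˢ Set.univ, fun t p => F₀ p.2 + zetaDiff b ℓ₀ (Λ t p.1) p.2,
    fun t => ⟨Metric.isOpen_ball.prod isOpen_univ, ?_, ⟨Metric.mem_ball_self (half_pos hc),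
      trivial⟩, ?_⟩, ?_, ?_⟩
  · exact ((convex_ball _ _).isConnected (Metric.nonempty_ball.2 (half_pos hc))).prod
      isConnected_univ
  · obtain ⟨A, hA, hAb⟩ := hΛ t
    exact isMeromorphicIn_add hF₀.1 Metric.isOpen_ball (differentiableOn_zetaDiff hK hA b
      Metric.isOpen_ball (fun n => differentiableOn_localLog hc (hlow t) n) hAb)
  -- For times closer than `δ`, the whole intermediate piece of path lies in the ball about `σ t₂`,
  -- as the comparison of logarithms needs.
  · obtain ⟨δ, hδ, hδσ⟩ := Metric.uniformContinuous_iff.1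
      (CompactSpace.uniformContinuous_of_continuous hσ) (c / 2) (half_pos hc)
    refine ⟨δ, hδ, fun t₁ t₂ ht => ?_⟩
    have hopen : IsOpen ((U t₁ ×ˢ (Set.univ : Set ℂ)) ∩ (U t₂ ×ˢ Set.univ)) :=
      (Metric.isOpen_ball.prod isOpen_univ).inter (Metric.isOpen_ball.prod isOpen_univ)
    refine (interior_maximal ?_ hopen).trans subset_closure
    rintro ⟨w, s⟩ ⟨⟨hw₁, -⟩, hw₂, -⟩
    have heq : Λ t₁ w = Λ t₂ w := funext fun n =>
      localLog_eq_of_lift hσ hc hlow hL hexp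
        (fun τ hτ => hδσ (((Real.dist_right_le_of_mem_uIcc
          (Set.mem_uIcc.2 (Set.mem_uIcc.1 hτ)) : dist (τ : ℝ) t₂ ≤ dist (t₁ : ℝ) t₂)).trans_lt ht))
        hw₁ hw₂ n
    simp only [Set.mem_ofPred_eq, heq]
  -- Near the start `Re s > 1`, so `F₀` is the original series and adding the difference restores
  -- the series at `w`.
  · have hopen : IsOpen (U 0 ×ˢ {s : ℂ | 1 < s.re}) :=
      Metric.isOpen_ball.prod (isOpen_lt continuous_const Complex.continuous_re)
    have hmem : γ 0 ∈ U 0 ×ˢ {s : ℂ | 1 < s.re} :=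
      ⟨Metric.mem_ball_self (half_pos hc), by rw [hγ0]; exact hs₀⟩
    filter_upwards [hopen.mem_nhds hmem] with p hp
    obtain ⟨A, hA, hAb⟩ := hΛ 0
    have hexp' := exp_localLog hc (hlow 0) (hexp 0) hp.1
    have hbr : IsLogBranch (z₀ + p.1.incl) (Λ 0 p.1) := hℓ₀.of_bound hA hexp' (hAb p.1 hp.1)
    have hdom : p.1 ∈ affineDomain z₀ := mem_affineDomain_of_forall_ne_zero hz₀ fun n => by
      rw [← hexp' n]
      exact Complex.exp_ne_zero _
    have hΛ0 : (fun n => ℓ₀ n + Complex.log (1 + p.1 n / z₀ n)) = Λ 0 p.1 := by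
      funext n
      simp [Λ, localLog, hσ0, hL0, SeqSpace.zero_apply]
    rw [hF₀.2 p.2 hp.2, zetaElement, hΛ0,
      zetaBranch_eq_add_zetaDiff hz₀ hℓ₀ hdom hbr b hp.2]

theorem mainTheorem1 (b₀ : lp (fun _ : ℕ+ => ℂ) ∞) (z₀ : SeqSpace invRad) (ℓ₀ : ℕ+ → ℂ)
    (hM : (b₀, z₀, ℓ₀) ∈ zetaM) :
    (∀ w : SeqSpace expRad, w ∈ Metric.ball 0 ‖z₀‖ → w ∈ affineDomain z₀ →
      (∃ ℓ, BranchContinues z₀ ℓ₀ (Metric.ball 0 ‖z₀‖ ∩ affineDomain z₀) w ℓ) ∧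
      ∀ ℓ, BranchContinues z₀ ℓ₀ (Metric.ball 0 ‖z₀‖ ∩ affineDomain z₀) w ℓ →
        (b₀, z₀ + w.incl, ℓ) ∈ zetaM ∧
        ∀ F₀ F, IsZetaExtension b₀ ℓ₀ F₀ → IsZetaExtension b₀ ℓ F → SamePoles F F₀) ∧
    (∀ s₀ : ℂ, 1 < s₀.re →
      ContinuesMultivalued (zetaElement b₀ z₀ ℓ₀) (0, s₀)
        (affineDomain z₀ ×ˢ (Set.univ : Set ℂ))) := by
  obtain ⟨hz₀, hℓ₀, G, hG⟩ := hM
  refine ⟨fun w hw hwD => ⟨exists_branchContinues hz₀ hℓ₀ hw hwD, ?_⟩,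
    fun s₀ hs₀ => continuesMultivalued_zetaElement hz₀ hℓ₀ hG hs₀⟩
  rintro ℓ ⟨γ, -, L, hL, hexp, hL0, rfl⟩
  obtain ⟨A, hA, hAb⟩ := exists_bound_of_lift γ.continuous γ.source hz₀ hL hexp hL0 1
  obtain ⟨K, hK⟩ := hℓ₀.exists_norm_le hz₀
  have hbr : IsLogBranch (z₀ + w.incl) (L 1) := by
    refine hℓ₀.of_bound hA (fun n => ?_) hAb
    rw [hexp, γ.target]
    rfl
  have hH := differentiable_zetaDiff hK hA b₀ hAb
  have hHm : Meromorphic (zetaDiff b₀ ℓ₀ (L 1)) := fun s => (hH.analyticAt s).meromorphicAt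
  have hsum : ∀ s : ℂ, 1 < s.re →
      zetaBranch b₀ (L 1) s = zetaBranch b₀ ℓ₀ s + zetaDiff b₀ ℓ₀ (L 1) s := fun s hs =>
    zetaBranch_eq_add_zetaDiff hz₀ hℓ₀ hwD hbr b₀ hs
  refine ⟨⟨hwD, hbr, G + zetaDiff b₀ ℓ₀ (L 1), hG.1.add hHm, fun s hs => ?_⟩,
    fun F₀ F hF₀ hF => ?_⟩
  · rw [hsum s hs, Pi.add_apply, hG.2 s hs]
  · refine SamePoles.of_eqOn_add hF.1 hF₀.1 hH
      (isOpen_lt continuous_const Complex.continuous_re) ⟨2, show (1 : ℝ) < (2 : ℂ).re by norm_num⟩ fun s hs => ?_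
    rw [hF.2 s hs, hF₀.2 s hs, hsum s hs]
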